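/- Let $n\ge 2$, $m\ge 2$ be integers and $M>0$ real. Let $N=\{1,\dots,n\}$ be the set of agents, $A=\{a_1,\dots,a_m\}$ the set of alternatives, and $V$ the set of all profiles $v=(v_1,\dots,v_n)$ of valuations $v_i:A\to(-\tfrac M2,\tfrac M2)$. A deterministic mechanism $\langle f,\mathbf p\rangle$ consists of a social choice function $f:V\to A$ and payments $p_i:V\to\mathbb R$, $i\in N$. It is *strategyproof* if $v_i(f(v_i,v_{-i}))-p_i(v_i,v_{-i})\ge v_i(f(v_i',v_{-i}))-p_i(v_i',v_{-i})$ for all $v\in V$, all $i\in N$ and all valuations $v_i'$; *budget balanced* if $\sum_{i\in N}p_i(v)=0$ for all $v\in V$. For a permutation $\pi$ of $A$ let $\pi(v)$ be the profile with $\pi(v)_i(\pi(a))=v_i(a)$. The mechanism is *neutral* (up to tie-breaking) if $f(\pi(v))=\pi(f(v))$ and $p_i(\pi(v))=p_i(v)$ for all $i\in N$, for every permutation $\pi$ and every $v\in V$ such that $\pi(v)\ne v$ and $v$ is not a tie of $f$, i.e. $f$ is constant on a neighbourhood of $v$. The worst-case sample inefficiency is $$r_n^M(f)=\frac1{nM}\sup_{v\in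 V}\Big[\max_{a\in A}\sum_{i\in N}v_i(a)-\sum_{i\in N}v_i(f(v))\Big].$$ Theorem. Every deterministic, strategyproof, budget-balanced, neutral mechanism $\langle f,\mathbf p\rangle$ on $V$ satisfies $r_n^M(f)\ge\frac1n$. This bound is tight: for every agent $s\in N$ there are mechanisms for which $f(v)$ does not depend on $v_s$, $f(v)\in\arg\max_{a\in A}\sum_{j\ne s}v_j(a)$ for all $v$, every agent $i\ne s$ pays $p_i(v)=\max_{a\in A}\sum_{j\ne s,i}v_j(a)-\sum_{j\ne s,i}v_j(f(v))$, and $p_s(v)=-\sum_{j\ne s}p_j(v)$; and every such mechanism is strategyproof, budget balanced and neutral and has $r_n^M(f)=\frac1n$. -/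

import Mathlib

open scoped BigOperators Topology

/-- A valuation of one agent: every one of the `m` alternatives gets a value in the open
interval `(-M/2, M/2)`. -/
abbrev AgentValuation (m : ℕ) (M : ℝ) : Type := Fin m → Set.Ioo (-(M / 2)) (M / 2)

/-- The domain `V`: profiles of valuations of `n` agents. -/
abbrev Profile (n m : ℕ) (M : ℝ) : Type := Fin n → AgentValuation m M

/-- A deterministic mechanism: a social choice function, and a payment of every agent. -/
structure Mechanism (n m : ℕ) (M : ℝ) where
  alloc : Profile n m M → Fin m
  pay : Profile n m M → Fin n → ℝ

/-- The total value of alternative `a` to the agents in `S`. -/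
def welfare {n m : ℕ} {M : ℝ} (S : Finset (Fin n)) (v : Profile n m M) (a : Fin m) : ℝ :=
  ∑ i ∈ S, (v i a : ℝ)

/-- The profile `π(v)`, in which `π a` is valued as `a` is in `v`. -/
def permute {n m : ℕ} {M : ℝ} (π : Equiv.Perm (Fin m)) (v : Profile n m M) : Profile n m M :=
  fun i a => v i (π.symm a)

/-- The profile `v` is not a tie of `f`: all profiles close to `v` get the same alternative. -/
def TieFree {n m : ℕ} {M : ℝ} (f : Profile n m M → Fin m) (v : Profile n m M) : Prop :=
  ∀ᶠ w in 𝓝 v, f w = f v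

namespace Mechanism

variable {n m : ℕ} {M : ℝ}

/-- No agent gains by a misreport, whatever the others report. -/
def Strategyproof (μ : Mechanism n m M) : Prop :=
  ∀ (v : Profile n m M) (i : Fin n) (x : AgentValuation m M),
    (v i (μ.alloc (Function.update v i x)) : ℝ) - μ.pay (Function.update v i x) i
      ≤ (v i (μ.alloc v) : ℝ) - μ.pay v i

/-- The payments sum to zero at every profile. -/
def BudgetBalanced (μ : Mechanism n m M) : Prop :=
  ∀ v : Profile n m M, ∑ i, μ.pay v i = 0

/-- Neutrality up to tie-breaking: renaming the alternatives renames the chosen one and does not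
change the payments; as usual this says nothing about profiles that the renaming fixes, nor about
profiles at which the choice is a matter of breaking a tie. -/
def Neutral (μ : Mechanism n m M) : Prop :=
  ∀ (π : Equiv.Perm (Fin m)) (v : Profile n m M), permute π v ≠ v → TieFree μ.alloc v →
    μ.alloc (permute π v) = π (μ.alloc v) ∧ ∀ i, μ.pay (permute π v) i = μ.pay v i

/-- The sample inefficiency `r_n^M(f)`: the worst loss of welfare, divided by `n M`. For `0 < M`
and `0 < m` the set of losses is non-empty and bounded (by `n M`), so that this is a genuine
supremum. -/
noncomputable def sampleInefficiency (μ : Mechanism n m M) : ℝ :=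
  1 / (n * M) * ⨆ v : Profile n m M,
    ((⨆ a : Fin m, welfare Finset.univ v a) - welfare Finset.univ v (μ.alloc v))

/-- The single-sink mechanisms with sink `s`: the report of `s` has no influence on the choice, the
choice maximizes the equally weighted welfare of the other agents, these make Clarke payments in
the economy without `s`, and `s` receives the sum of their payments. Ties may be broken in any
way that does not use the report of `s`. -/
structure IsEfficientSingleSink (μ : Mechanism n m M) (s : Fin n) : Prop where
  ignores_sink : ∀ v w : Profile n m M, (∀ j, j ≠ s → v j = w j) → μ.alloc v = μ.alloc w
  maximizes : ∀ (v : Profile n m M) (a : Fin m),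
    welfare (Finset.univ.erase s) v a ≤ welfare (Finset.univ.erase s) v (μ.alloc v)
  clarke : ∀ (v : Profile n m M) (j : Fin n), j ≠ s →
    μ.pay v j = (⨆ a : Fin m, welfare ((Finset.univ.erase s).erase j) v a)
      - welfare ((Finset.univ.erase s).erase j) v (μ.alloc v)
  sink_pay : ∀ v : Profile n m M, μ.pay v s = -∑ j ∈ Finset.univ.erase s, μ.pay v j

end Mechanism

/-! ### Lower bound on the inefficiency -/

namespace Mechanism

variable {n m : ℕ} {M : ℝ}

/-! Lower bound (`le_iSup_loss`): suppose all losses stay below some `L < M`. Let every agent value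
`a` and `b` near `M/2` and the rest near `-M/2`. Then `a` or `b` is chosen, and any nonempty set of
agents that drop one of the two to near `-M/2` forces the other. By `sum_pay_sub_pay_update_eq_zero`
the payment changes under the single drops sum to zero. Applied to drops of `b`, this forces `a`
whenever the total advantage of `a` over `b` is positive. If all advantages are positive, `a`
therefore survives even when one agent's advantage turns slightly negative. That agent's payment is
unchanged, so its incentive constraint bounds its payment change under a drop of `a` by a negative
number, and these changes cannot sum to zero.

Tightness: only the sink's values are neglected, and they differ by less than `M`; incentives are
those of Clarke payments, and neutrality follows from uniqueness of the maximizer off ties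
(`welfare_lt`). -/

theorem Strategyproof.pay_update_eq {μ : Mechanism n m M} (h : μ.Strategyproof)
    (v : Profile n m M) (i : Fin n) (x : AgentValuation m M)
    (hx : μ.alloc (Function.update v i x) = μ.alloc v) :
    μ.pay (Function.update v i x) i = μ.pay v i := by
  have h1 := h v i x
  have h2 := h (Function.update v i x) i (v i)
  simp only [Function.update_idem, Function.update_eq_self, Function.update_self] at h2
  rw [hx] at h1 h2
  linarith

/-- If every mixture of `v` and `w` other than `v` itself leads to the choice of `b`, then the
payment changes caused by the single deviations from `v` to `w` sum to zero. -/
theorem sum_pay_sub_pay_update_eq_zero {μ : Mechanism n m M} (h : μ.Strategyproof)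
    (hb : μ.BudgetBalanced) (v w : Profile n m M) (b : Fin m)
    (hw : ∀ S : Finset (Fin n), S.Nonempty → μ.alloc (S.piecewise w v) = b) :
    ∑ j, (μ.pay v j - μ.pay (Function.update v j (w j)) j) = 0 := by
  -- Alternating sum over mixtures: for nonempty `S` without `j`, the terms of `S` and `insert j S`
  -- cancel, since the choice, hence the payment of `j`, is the same at both. Only `∅` and `{j}`
  -- remain. Summed over `j` first, each `S` contributes zero by budget balance.
  have key : ∀ j, μ.pay v j - μ.pay (Function.update v j (w j)) j =
      ∑ S ∈ (Finset.univ : Finset (Fin n)).powerset,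
        (-1 : ℝ) ^ S.card * μ.pay (S.piecewise w v) j := by
    intro j
    have hj : (Finset.univ : Finset (Fin n)) = insert j (Finset.univ.erase j) :=
      (Finset.insert_erase (Finset.mem_univ j)).symm
    rw [hj, Finset.sum_powerset_insert (Finset.notMem_erase j _), ← Finset.sum_add_distrib,
      Finset.sum_eq_single_of_mem ∅ (by simp)]
    · rw [Finset.piecewise_insert, Finset.piecewise_empty]
      simp [sub_eq_add_neg]
    · intro S hS hne
      have hjS : j ∉ S := fun hjS => by simpa using Finset.mem_powerset.1 hS hjS
      rw [Finset.card_insert_of_notMem hjS, Finset.piecewise_insert, h.pay_update_eq]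
      · ring
      · rw [← Finset.piecewise_insert, hw _ (Finset.insert_nonempty j S),
          hw S (Finset.nonempty_iff_ne_empty.2 hne)]
  rw [Finset.sum_congr rfl fun j _ => key j, Finset.sum_comm]
  refine Finset.sum_eq_zero fun S _ => ?_
  rw [← Finset.mul_sum, hb, mul_zero]

theorem welfare_le (S : Finset (Fin n)) (v : Profile n m M) (a : Fin m) :
    welfare S v a ≤ S.card * (M / 2) := by
  rw [welfare, ← nsmul_eq_mul]
  exact Finset.sum_le_card_nsmul _ _ _ fun i _ => (v i a).2.2.le

theorem le_welfare (S : Finset (Fin n)) (v : Profile n m M) (a : Fin m) :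
    -(S.card * (M / 2)) ≤ welfare S v a := by
  rw [welfare, ← mul_neg, ← nsmul_eq_mul]
  exact Finset.card_nsmul_le_sum _ _ _ fun i _ => (v i a).2.1.le

theorem bddAbove_range_loss [Nonempty (Fin m)] (μ : Mechanism n m M) :
    BddAbove (Set.range fun v : Profile n m M =>
      (⨆ a : Fin m, welfare Finset.univ v a) - welfare Finset.univ v (μ.alloc v)) := by
  refine ⟨n * M, ?_⟩
  rintro _ ⟨v, rfl⟩
  have h1 : (⨆ a : Fin m, welfare Finset.univ v a) ≤ n * (M / 2) :=
    ciSup_le fun a => by simpa using welfare_le Finset.univ v a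
  have h2 : -(n * (M / 2)) ≤ welfare Finset.univ v (μ.alloc v) := by
    simpa using le_welfare Finset.univ v (μ.alloc v)
  dsimp only
  linarith

theorem loss_le_iSup [Nonempty (Fin m)] (μ : Mechanism n m M) (v : Profile n m M) (a : Fin m) :
    welfare Finset.univ v a - welfare Finset.univ v (μ.alloc v) ≤
      ⨆ v : Profile n m M,
        ((⨆ a : Fin m, welfare Finset.univ v a) - welfare Finset.univ v (μ.alloc v)) :=
  (sub_le_sub_right (le_ciSup (Set.finite_range _).bddAbove a) _).trans
    (le_ciSup μ.bddAbove_range_loss v)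

/-- The valuation `x` of `a`, `y` of `b` and `z` of every other alternative. -/
def pairValuation (a b : Fin m) (x y z : Set.Ioo (-(M / 2)) (M / 2)) : AgentValuation m M :=
  fun c => if c = a then x else if c = b then y else z

/-- A strategyproof and budget-balanced mechanism has losses arbitrarily close to `M`. -/
theorem le_iSup_loss (hn : 2 ≤ n) (hm : 2 ≤ m) (hM : 0 < M) {μ : Mechanism n m M}
    (h : μ.Strategyproof) (hb : μ.BudgetBalanced) :
    M ≤ ⨆ v : Profile n m M,
      ((⨆ a : Fin m, welfare Finset.univ v a) - welfare Finset.univ v (μ.alloc v)) := by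
  have : Nonempty (Fin m) := ⟨⟨0, by omega⟩⟩
  set L := ⨆ v : Profile n m M,
      ((⨆ a : Fin m, welfare Finset.univ v a) - welfare Finset.univ v (μ.alloc v))
  by_contra! hlt
  have hloss : ∀ (v : Profile n m M) (a : Fin m),
      welfare Finset.univ v a - welfare Finset.univ v (μ.alloc v) ≤ L := μ.loss_le_iSup
  have hL0 : 0 ≤ L := by
    let v : Profile n m M := fun _ _ => ⟨0, by constructor <;> linarith⟩
    simpa using hloss v (μ.alloc v)
  let a : Fin m := ⟨0, by omega⟩
  let b : Fin m := ⟨1, by omega⟩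
  have hba : b ≠ a := by simp [a, b]
  have hn' : (2 : ℝ) ≤ n := by exact_mod_cast hn
  -- With `k = M/2 - 2η`, the perturbed value `k + η` stays below `M/2`, and the loss in
  -- `not_chosen` is at least `2k - η - (n-1)η = M - (n+4)η = L + η`.
  obtain ⟨η, hη, hηL⟩ : ∃ η : ℝ, 0 < η ∧ (n + 5) * η = M - L :=
    ⟨(M - L) / (n + 5), div_pos (by linarith) (by linarith), by field_simp⟩
  have hη7 : 7 * η ≤ M - L := by rw [← hηL]; nlinarith
  obtain ⟨k, hk⟩ : ∃ k, k = M / 2 - 2 * η := ⟨_, rfl⟩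
  have hk0 : 0 < k := by linarith
  have not_chosen : ∀ (v : Profile n m M) (c z : Fin m) (i : Fin n),
      (∀ j, -η ≤ (v j c : ℝ) - v j z) → 2 * k - η ≤ (v i c : ℝ) - v i z → μ.alloc v ≠ z := by
    intro v c z i hj hi hz
    have h1 := hloss v c
    rw [hz, welfare, welfare, ← Finset.sum_sub_distrib,
      ← Finset.add_sum_erase _ _ (Finset.mem_univ i)] at h1
    have h2 := Finset.card_nsmul_le_sum (Finset.univ.erase i)
      (fun j => (v j c : ℝ) - v j z) (-η) fun j _ => hj j
    have h3 : ((Finset.univ.erase i : Finset (Fin n)).card : ℝ) = n - 1 := by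
      rw [Finset.card_erase_of_mem (Finset.mem_univ i), Finset.card_fin,
        Nat.cast_sub (by omega), Nat.cast_one]
    rw [nsmul_eq_mul, h3] at h2
    linarith
  let kk : Set.Ioo (-(M / 2)) (M / 2) := ⟨k, by constructor <;> linarith⟩
  let nk : Set.Ioo (-(M / 2)) (M / 2) := ⟨-k, by constructor <;> linarith⟩
  let pert : Set.Icc (-η) η → Set.Ioo (-(M / 2)) (M / 2) := fun d =>
    ⟨k + d, by have := d.2.1; have := d.2.2; constructor <;> linarith⟩
  let hi : Profile n m M := fun _ => pairValuation a b kk nk nk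
  let lo : Profile n m M := fun _ => pairValuation a b nk kk nk
  let near : (Fin n → Set.Icc (-η) η) → Profile n m M := fun d i =>
    pairValuation a b (pert (d i)) kk nk
  have near_alloc : ∀ d, μ.alloc (near d) = a ∨ μ.alloc (near d) = b := by
    intro d
    by_contra! hd
    have hdi : ∀ i, 2 * k - η ≤ (near d i a : ℝ) - near d i (μ.alloc (near d)) := fun i => by
      have := (d i).2.1
      simp only [near, pairValuation, pert, nk, hd.1, hd.2, if_true, if_false]
      linarith
    exact not_chosen (near d) a _ ⟨0, by omega⟩ (fun j => by linarith [hdi j]) (hdi _) rfl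
  have lo_alloc : ∀ d (S : Finset (Fin n)), S.Nonempty →
      μ.alloc (S.piecewise lo (near d)) = b := by
    rintro d S ⟨i, hi⟩
    by_contra hz
    refine not_chosen (S.piecewise lo (near d)) b _ i (fun j => ?_) ?_ rfl
    · have := (d j).2.2
      by_cases hj : j ∈ S <;> by_cases hza : μ.alloc (S.piecewise lo (near d)) = a <;>
      simp only [hj, hza, hz, hba, lo, near, pairValuation, pert, kk, nk, if_true, if_false,
        Finset.piecewise_eq_of_mem, Finset.piecewise_eq_of_notMem, not_false_eq_true] <;> linarith
    · by_cases hza : μ.alloc (S.piecewise lo (near d)) = a <;>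
      simp only [hi, hza, hz, hba, lo, pairValuation, kk, nk, if_true, if_false,
        Finset.piecewise_eq_of_mem] <;> linarith
  have hi_alloc : ∀ d (S : Finset (Fin n)), S.Nonempty →
      μ.alloc (S.piecewise hi (near d)) = a := by
    rintro d S ⟨i, hiS⟩
    by_contra hz
    refine not_chosen (S.piecewise hi (near d)) a _ i (fun j => ?_) ?_ rfl
    · have := (d j).2.1
      by_cases hj : j ∈ S <;> by_cases hzb : μ.alloc (S.piecewise hi (near d)) = b <;>
      simp only [hj, hzb, hz, hba, hi, near, pairValuation, pert, kk, nk, if_true, if_false,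
        Finset.piecewise_eq_of_mem, Finset.piecewise_eq_of_notMem, not_false_eq_true] <;> linarith
    · by_cases hzb : μ.alloc (S.piecewise hi (near d)) = b <;>
      simp only [hiS, hzb, hz, hba, hi, pairValuation, kk, nk, if_true, if_false,
        Finset.piecewise_eq_of_mem] <;> linarith
  have near_eq_a : ∀ d : Fin n → Set.Icc (-η) η, 0 < ∑ i, (d i : ℝ) → μ.alloc (near d) = a := by
    intro d hd
    refine (near_alloc d).resolve_right fun hdb => ?_
    have h0 := sum_pay_sub_pay_update_eq_zero h hb (near d) hi a (hi_alloc d)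
    have h1 : ∑ j, (μ.pay (near d) j - μ.pay (Function.update (near d) j (hi j)) j) ≤
        ∑ j, -(d j : ℝ) := by
      refine Finset.sum_le_sum fun j _ => ?_
      have h2 := h (near d) j (hi j)
      have h3 : μ.alloc (Function.update (near d) j (hi j)) = a := by
        rw [← Finset.piecewise_singleton]
        exact hi_alloc d _ (Finset.singleton_nonempty j)
      rw [h3, hdb] at h2
      simp only [near, pairValuation, pert, kk, hba, if_true, if_false] at h2 ⊢
      linarith
    rw [h0, Finset.sum_neg_distrib] at h1
    linarith
  let top : Set.Icc (-η) η := ⟨η, by constructor <;> linarith⟩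
  -- Negative, so the bound on each payment change is strict; yet the total advantage `(n-1)η - η/2`
  -- stays positive because `n ≥ 2`.
  let dip : Set.Icc (-η) η := ⟨-η / 2, by constructor <;> linarith⟩
  let D : Fin n → Set.Icc (-η) η := fun _ => top
  have hD : μ.alloc (near D) = a := by
    apply near_eq_a
    simp only [D, top, Finset.sum_const, Finset.card_fin, nsmul_eq_mul]
    positivity
  have hDi : ∀ i, μ.alloc (near (Function.update D i dip)) = a := by
    intro i
    apply near_eq_a
    rw [← Finset.add_sum_erase _ _ (Finset.mem_univ i), Function.update_self,
      Finset.sum_congr rfl fun j hj => by rw [Function.update_of_ne (Finset.ne_of_mem_erase hj)]]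
    simp only [D, top, dip, Finset.sum_const, Finset.card_erase_of_mem (Finset.mem_univ i),
      Finset.card_fin, nsmul_eq_mul]
    rw [Nat.cast_sub (by omega), Nat.cast_one]
    nlinarith
  have near_update : ∀ i, near (Function.update D i dip) =
      Function.update (near D) i (near (Function.update D i dip) i) := by
    intro i
    funext j
    by_cases hj : j = i
    · subst hj; simp
    · simp [near, hj]
  have h0 := sum_pay_sub_pay_update_eq_zero h hb (near D) lo b (lo_alloc D)
  have h1 : ∑ j, (μ.pay (near D) j - μ.pay (Function.update (near D) j (lo j)) j) ≤
      ∑ _j : Fin n, -η / 2 := by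
    refine Finset.sum_le_sum fun j _ => ?_
    -- The deviation starts from the dipped report, whose payment equals that at `near D`; starting
    -- from `near D` would only give the bound `η`.
    have h2 := h (near (Function.update D j dip)) j (lo j)
    have h3 : μ.pay (near (Function.update D j dip)) j = μ.pay (near D) j := by
      rw [near_update]
      apply h.pay_update_eq
      rw [← near_update, hDi, hD]
    have h4 : μ.alloc (Function.update (near D) j (lo j)) = b := by
      rw [← Finset.piecewise_singleton]
      exact lo_alloc D _ (Finset.singleton_nonempty j)
    rw [h3, hDi, near_update, Function.update_idem, h4] at h2
    simp only [near, pairValuation, pert, kk, dip, hba, if_true, if_false,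
      Function.update_self] at h2 ⊢
    linarith
  rw [h0, Finset.sum_const, Finset.card_fin, nsmul_eq_mul] at h1
  nlinarith

theorem one_div_le_sampleInefficiency (hn : 2 ≤ n) (hm : 2 ≤ m) (hM : 0 < M)
    {μ : Mechanism n m M} (h : μ.Strategyproof) (hb : μ.BudgetBalanced) :
    1 / (n : ℝ) ≤ μ.sampleInefficiency := by
  have hn' : (0 : ℝ) < n := by exact_mod_cast (by omega : 0 < n)
  calc 1 / (n : ℝ) = 1 / (n * M) * M := by field_simp
    _ ≤ _ := mul_le_mul_of_nonneg_left (le_iSup_loss hn hm hM h hb) (by positivity)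

/-! ### Single-sink mechanisms attain the bound -/

theorem exists_isEfficientSingleSink (hm : 0 < m) (s : Fin n) :
    ∃ μ : Mechanism n m M, μ.IsEfficientSingleSink s := by
  have : Nonempty (Fin m) := ⟨⟨0, hm⟩⟩
  choose best hbest using fun g : Fin m → ℝ => Finite.exists_max g
  let f : Profile n m M → Fin m := fun v => best (welfare (Finset.univ.erase s) v)
  let q : Profile n m M → Fin n → ℝ := fun v j =>
    (⨆ a : Fin m, welfare ((Finset.univ.erase s).erase j) v a)
      - welfare ((Finset.univ.erase s).erase j) v (f v)
  refine ⟨⟨f, fun v j => if j = s then -∑ i ∈ Finset.univ.erase s, q v i else q v j⟩, ?_, ?_, ?_, ?_⟩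
  · intro v w hvw
    refine congrArg best (funext fun a => Finset.sum_congr rfl fun j hj => ?_)
    rw [hvw j (Finset.ne_of_mem_erase hj)]
  · exact fun v a => hbest _ a
  · intro v j hj
    simp only [if_neg hj, q]
  · intro v
    simp only [if_true]
    congr 1
    exact Finset.sum_congr rfl fun j hj => (if_neg (Finset.ne_of_mem_erase hj)).symm

theorem welfare_update_of_notMem {S : Finset (Fin n)} {i : Fin n} (hi : i ∉ S)
    (v : Profile n m M) (x : AgentValuation m M) (a : Fin m) :
    welfare S (Function.update v i x) a = welfare S v a :=
  Finset.sum_congr rfl fun j hj => by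
    rw [Function.update_of_ne (ne_of_mem_of_not_mem hj hi)]

theorem welfare_permute (S : Finset (Fin n)) (π : Equiv.Perm (Fin m)) (v : Profile n m M)
    (a : Fin m) : welfare S (permute π v) a = welfare S v (π.symm a) := rfl

namespace IsEfficientSingleSink

variable {μ : Mechanism n m M} {s : Fin n}

theorem budgetBalanced (h : μ.IsEfficientSingleSink s) : μ.BudgetBalanced := by
  intro v
  rw [← Finset.add_sum_erase _ _ (Finset.mem_univ s), h.sink_pay, neg_add_cancel]

/-- The sink affects neither the choice nor the Clarke payments it collects. For any other agent,
utility is the welfare without the sink minus a term independent of its report, and truth maximizes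
that welfare. -/
theorem strategyproof (h : μ.IsEfficientSingleSink s) : μ.Strategyproof := by
  intro v i x
  by_cases hi : i = s
  · subst hi
    have halloc : μ.alloc (Function.update v i x) = μ.alloc v :=
      h.ignores_sink _ _ fun j hj => Function.update_of_ne hj _ _
    have hpay : μ.pay (Function.update v i x) i = μ.pay v i := by
      rw [h.sink_pay, h.sink_pay]
      congr 1
      refine Finset.sum_congr rfl fun j hj => ?_
      have hji := Finset.ne_of_mem_erase hj
      have hmem : i ∉ (Finset.univ.erase i).erase j := by simp
      simp only [h.clarke _ j hji, halloc, welfare_update_of_notMem hmem]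
    rw [halloc, hpay]
  · have hmem : i ∈ Finset.univ.erase s := by simp [hi]
    have hnot : i ∉ (Finset.univ.erase s).erase i := Finset.notMem_erase i _
    have key : ∀ a, welfare (Finset.univ.erase s) v a =
        v i a + welfare ((Finset.univ.erase s).erase i) v a := fun a =>
      (Finset.add_sum_erase _ _ hmem).symm
    have hmax := h.maximizes v (μ.alloc (Function.update v i x))
    rw [key, key] at hmax
    simp only [h.clarke _ i hi, welfare_update_of_notMem hnot]
    linarith

/-- At a tie-free profile the chosen alternative is the only maximizer. -/
theorem welfare_lt (h : μ.IsEfficientSingleSink s) (hn : 2 ≤ n) {v : Profile n m M}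
    (hv : TieFree μ.alloc v) {b : Fin m} (hb : b ≠ μ.alloc v) :
    welfare (Finset.univ.erase s) v b < welfare (Finset.univ.erase s) v (μ.alloc v) := by
  refine lt_of_le_of_ne (h.maximizes v b) fun heq => ?_
  have : Nontrivial (Fin n) := Fin.nontrivial_iff_two_le.2 hn
  obtain ⟨j, hj⟩ := exists_ne s
  have hlt : (v j b : ℝ) < M / 2 := (v j b).2.2
  -- Raise the value of `b` to an agent `j` other than the sink; the projection keeps it in the open
  -- interval. Near `v` the choice does not change, but after any increase a tied `b` would be
  -- strictly better.
  let w : ℝ → Profile n m M := fun t =>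
    Function.update v j (Function.update (v j) b
      (Set.projIcc (v j b : ℝ) ((v j b + M / 2) / 2) (by linarith) t |> fun y =>
        ⟨y, (v j b).2.1.trans_le y.2.1, y.2.2.trans_lt (by linarith)⟩))
  have hw0 : w (v j b) = v := by
    simp [w]
  have hcont : Continuous w := by
    refine continuous_const.update j (continuous_const.update b ?_)
    exact Continuous.subtype_mk (continuous_subtype_val.comp continuous_projIcc) _
  have hev : ∀ᶠ t in 𝓝 (v j b : ℝ), μ.alloc (w t) = μ.alloc v := by
    have h1 : Filter.Tendsto w (𝓝 (v j b : ℝ)) (𝓝 v) := by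
      simpa only [hw0] using hcont.tendsto (v j b : ℝ)
    exact h1.eventually hv
  have hev' : ∀ᶠ t in 𝓝[>] (v j b : ℝ), μ.alloc (w t) = μ.alloc v :=
    hev.filter_mono nhdsWithin_le_nhds
  obtain ⟨t, ht, htm⟩ := (hev'.and (Ioo_mem_nhdsGT
    (show (v j b : ℝ) < (v j b + M / 2) / 2 by linarith))).exists
  have hmem : j ∈ Finset.univ.erase s := by simp [hj]
  have hmax := h.maximizes (w t) b
  rw [ht] at hmax
  have hwb : (w t j b : ℝ) = t := by
    simp [w, Set.projIcc_of_mem _ (Set.Ioo_subset_Icc_self htm)]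
  have hwa : w t j (μ.alloc v) = v j (μ.alloc v) := by
    simp [w, hb.symm]
  have key : ∀ (u : Profile n m M) a, welfare (Finset.univ.erase s) u a =
      u j a + welfare ((Finset.univ.erase s).erase j) u a := fun u a =>
    (Finset.add_sum_erase _ _ hmem).symm
  rw [key, key] at hmax heq
  rw [hwb, hwa] at hmax
  simp only [w, welfare_update_of_notMem (Finset.notMem_erase j _)] at hmax
  linarith [htm.1]

theorem neutral (h : μ.IsEfficientSingleSink s) (hn : 2 ≤ n) : μ.Neutral := by
  intro π v _ hv
  have halloc : μ.alloc (permute π v) = π (μ.alloc v) := by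
    by_contra hne
    have hmax := h.maximizes (permute π v) (π (μ.alloc v))
    rw [welfare_permute, welfare_permute, Equiv.symm_apply_apply] at hmax
    refine hmax.not_gt (h.welfare_lt hn hv fun heq => hne ?_)
    rw [← heq, Equiv.apply_symm_apply]
  have hpay : ∀ i, i ≠ s → μ.pay (permute π v) i = μ.pay v i := by
    intro i hi
    rw [h.clarke _ i hi, h.clarke _ i hi, halloc]
    simp only [welfare_permute, Equiv.symm_apply_apply]
    congr 1
    exact π.symm.iSup_comp (g := fun a => welfare ((Finset.univ.erase s).erase i) v a)
  refine ⟨halloc, fun i => ?_⟩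
  by_cases hi : i = s
  · subst hi
    rw [h.sink_pay, h.sink_pay]
    congr 1
    exact Finset.sum_congr rfl fun j hj => hpay j (Finset.ne_of_mem_erase hj)
  · exact hpay i hi

theorem sampleInefficiency_le (h : μ.IsEfficientSingleSink s) (hm : 0 < m) (hM : 0 < M) :
    μ.sampleInefficiency ≤ 1 / (n : ℝ) := by
  have : Nonempty (Fin m) := ⟨⟨0, hm⟩⟩
  have : Nonempty (Profile n m M) := ⟨fun _ _ => ⟨0, by constructor <;> linarith⟩⟩
  have hn' : (0 : ℝ) < n := by exact_mod_cast s.pos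
  have hloss : ⨆ v : Profile n m M,
      ((⨆ a : Fin m, welfare Finset.univ v a) - welfare Finset.univ v (μ.alloc v)) ≤ M := by
    refine ciSup_le fun v => ?_
    rw [sub_le_iff_le_add]
    refine ciSup_le fun a => ?_
    have key : ∀ a, welfare Finset.univ v a = v s a + welfare (Finset.univ.erase s) v a :=
      fun a => (Finset.add_sum_erase _ _ (Finset.mem_univ s)).symm
    rw [key, key]
    linarith [h.maximizes v a, (v s a).2.2, (v s (μ.alloc v)).2.1]
  calc μ.sampleInefficiency ≤ 1 / (n * M) * M :=
        mul_le_mul_of_nonneg_left hloss (by positivity)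
    _ = 1 / (n : ℝ) := by field_simp

end IsEfficientSingleSink

end Mechanism

theorem theorem2 (n m : ℕ) (hn : 2 ≤ n) (hm : 2 ≤ m) (M : ℝ) (hM : 0 < M) :
    (∀ μ : Mechanism n m M, μ.Strategyproof → μ.BudgetBalanced → μ.Neutral →
      1 / (n : ℝ) ≤ μ.sampleInefficiency) ∧
    (∀ s : Fin n,
      (∃ μ : Mechanism n m M, μ.IsEfficientSingleSink s) ∧
      ∀ μ : Mechanism n m M, μ.IsEfficientSingleSink s →
        μ.Strategyproof ∧ μ.BudgetBalanced ∧ μ.Neutral ∧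
          μ.sampleInefficiency = 1 / (n : ℝ)) := by
  refine ⟨fun μ h hb _ => Mechanism.one_div_le_sampleInefficiency hn hm hM h hb, fun s =>
    ⟨Mechanism.exists_isEfficientSingleSink (by omega) s, fun μ h =>
      ⟨h.strategyproof, h.budgetBalanced, h.neutral hn,
        le_antisymm (h.sampleInefficiency_le (by omega) hM) ?_⟩⟩⟩
  exact Mechanism.one_div_le_sampleInefficiency hn hm hM h.strategyproof h.budgetBalanced
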